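/- Composition is written in diagrammatic (left-to-right) order, and the associativity and unit isomorphisms of $\otimes$ are suppressed. Let $\mathbb{R}\text{-}\mathrm{Vec}$ be the symmetric monoidal category of real vector spaces, with symmetry $\sigma$ and unit object $k = \mathbb{R}$. A $C^\infty$-ring is a set $A$ with an operation $\Phi_f : A^n \to A$ for every smooth $f : \mathbb{R}^n \to \mathbb{R}$, compatible with projections and composition. It has an underlying commutative $\mathbb{R}$-algebra, and the forgetful functor from $C^\infty$-rings to $\mathbb{R}\text{-}\mathrm{Vec}$ has a left adjoint. Let $\mathsf{S}^\infty = (S, \mu, \eta)$ be the induced monad on $\mathbb{R}\text{-}\mathrm{Vec}$, so that $S(\mathbb{R}^n) = C^\infty(\mathbb{R}^n)$, and let $\mathsf{m}_V : S V \otimes S V \to S V$ and $\mathsf{u}_V : k \to S V$ be the multiplication and unit of the algebra underlying the free $C^\infty$-ring $S V$. This makes $\mathsf{S}^\infty$ an algebra modality: $\mathsf m$ and $\mathsf u$ are natural, each $(SV, \mathsf m_V, \mathsf u_V)$ is a commutative monoid, and each $\mu_V$ is a monoid morphism. Let $\mathsf{d} : S(-) \Rightarrow S(-) \otimes (-)$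 be the smooth deriving transformation, i.e. the unique natural transformation with $\mathsf{d}_{\mathbb{R}^n}(f) = \sum_{i=1}^n \frac{\partial f}{\partial x_i} \otimes e_i$ for all $n$ and all $f \in C^\infty(\mathbb{R}^n)$. Put $\mathsf{d}^\circ := (1 \otimes \eta)\mathsf{m} : S(-) \otimes (-) \Rightarrow S$, let $S(0) : S \Rightarrow S$ have as components the images under $S$ of the zero maps $V \to V$, and put $\mathsf{K} := \mathsf{d}\mathsf{d}^\circ + S(0) : S \Rightarrow S$. **Theorem.** The monad $\mathsf{S}^\infty$ on $\mathbb{R}\text{-}\mathrm{Vec}$, with $\mathsf{d}$, has the structure of a codifferential category with antiderivatives, and therefore also that of a co-calculus category. Explicitly: 1. $\mathsf{d}$ is a deriving transformation: - $\mathsf{u}\mathsf{d} = 0$; - $\mathsf{m}\mathsf{d} = (1 \otimes \mathsf{d})(\mathsf{m} \otimes 1) + (\mathsf{d} \otimes 1)(1 \otimes \sigma)(\mathsf{m} \otimes 1)$; - $\eta\mathsf{d} = \mathsf{u} \otimes 1$; - $\mu\mathsf{d} = \mathsf{d}(\mu \otimes \mathsf{d})(\mathsf{m} \otimes 1)$;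 - $\mathsf{d}(\mathsf{d} \otimes 1) = \mathsf{d}(\mathsf{d} \otimes 1)(1 \otimes \sigma)$. 2. $\mathsf{K}$ is a natural isomorphism. 3. The natural transformation $\mathsf{s} := \mathsf{d}^\circ \mathsf{K}^{-1} : S(-) \otimes (-) \Rightarrow S$ is an integral transformation: - $(\mathsf{u} \otimes 1)\mathsf{s} = \eta$; - $(\mathsf{s} \otimes \mathsf{s})\mathsf{m} = (\mathsf{s} \otimes 1 \otimes 1)(\mathsf{m} \otimes 1)\mathsf{s} + (1 \otimes 1 \otimes \mathsf{s})(1 \otimes \sigma)(\mathsf{m} \otimes 1)\mathsf{s}$; - $(\mathsf{s} \otimes 1)\mathsf{s} = (1 \otimes \sigma)(\mathsf{s} \otimes 1)\mathsf{s}$. 4. $\mathsf{d}$ and $\mathsf{s}$ satisfy the second fundamental theorem of calculus, $\mathsf{d}\mathsf{s} + S(0) = 1$. 5. $\mathsf{d}$ and $\mathsf{s}$ satisfy the Poincaré condition: if a linear map $f : B \to S(V) \otimes V$ satisfies $f(\mathsf{d} \otimes 1)(1 \otimes \sigma) = f(\mathsf{d} \otimes 1)$, then $f\mathsf{s}\mathsf{d}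 = f$. -/

import Mathlib

open CategoryTheory MonoidalCategory
open scoped ContDiff TensorProduct

/-! ### Smooth functions on cartesian spaces -/

/-- `C^∞(ℝⁿ)`, the algebra of smooth real-valued functions on `ℝⁿ`. -/
def CInf (n : ℕ) : Subalgebra ℝ ((Fin n → ℝ) → ℝ) where
  carrier := {f | ContDiff ℝ ∞ f}
  mul_mem' {f g} hf hg := by
    have hf : ContDiff ℝ ∞ f := hf
    exact hf.mul hg
  add_mem' {f g} hf hg := by
    have hf : ContDiff ℝ ∞ f := hf
    exact hf.add hg
  algebraMap_mem' c := (contDiff_const : ContDiff ℝ ∞ fun _ : Fin n → ℝ => c)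

namespace CInf

theorem contDiff {n : ℕ} (f : CInf n) : ContDiff ℝ ∞ f.1 := f.2

/-- Construct an element of `C^∞(ℝⁿ)`. -/
def of {n : ℕ} (f : (Fin n → ℝ) → ℝ) (hf : ContDiff ℝ ∞ f) : CInf n := ⟨f, hf⟩

/-- The `i`-th coordinate projection. -/
def proj {n : ℕ} (i : Fin n) : CInf n := of (fun x => x i) (contDiff_apply ℝ ℝ i)

/-- The composite `g ∘ ⟨f₁, …, f_m⟩`. -/
def comp {m n : ℕ} (g : CInf m) (f : Fin m → CInf n) : CInf n :=
  of (fun x => g.1 fun i => (f i).1 x) ((contDiff g).comp (contDiff_pi.2 fun i => contDiff (f i)))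

/-- The partial derivative `∂f/∂xᵢ`. -/
noncomputable def pderiv {n : ℕ} (i : Fin n) (f : CInf n) : CInf n :=
  of (fun x => fderiv ℝ f.1 x (Pi.single i 1))
    (((contDiff f).fderiv_right (m := ∞) (by simp)).clm_apply contDiff_const)

/-- The linear form `x ↦ ∑ j, c j * x j`. -/
noncomputable def linForm {k : ℕ} (c : Fin k → ℝ) : CInf k := ∑ j, c j • proj j

theorem linForm_apply {k : ℕ} (c : Fin k → ℝ) (x : Fin k → ℝ) :
    (linForm c).1 x = ∑ j, c j * x j := by
  simp [linForm, proj, of]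

end CInf

/-! ### `C^∞`-rings -/

/-- A `C^∞`-ring: a set with an operation `Φ_f : X^n → X` for each smooth `f : ℝⁿ → ℝ`,
compatible with projections and composition. -/
structure CInfRing where
  carrier : Type
  op : ∀ {n : ℕ}, CInf n → (Fin n → carrier) → carrier
  op_proj : ∀ {n : ℕ} (i : Fin n) (a : Fin n → carrier), op (CInf.proj i) a = a i
  op_comp : ∀ {m n : ℕ} (g : CInf m) (f : Fin m → CInf n) (a : Fin n → carrier),
    op (CInf.comp g f) a = op g fun i => op (f i) a

namespace CInfRing

instance : CoeSort CInfRing Type := ⟨CInfRing.carrier⟩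

section Algebra

variable (A : CInfRing)

/-! The underlying commutative `ℝ`-algebra of a `C^∞`-ring: its operations are those induced by
the polynomials `x₀ + x₁`, `x₀ * x₁`, `-x₀` and the constants. -/

noncomputable instance : Add A := ⟨fun a b => A.op (CInf.proj 0 + CInf.proj 1) ![a, b]⟩
noncomputable instance : Mul A := ⟨fun a b => A.op (CInf.proj 0 * CInf.proj 1) ![a, b]⟩
noncomputable instance : Neg A := ⟨fun a => A.op (-CInf.proj 0) ![a]⟩
noncomputable instance : Zero A := ⟨A.op 0 ![]⟩
noncomputable instance : One A := ⟨A.op 1 ![]⟩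
noncomputable instance : SMul ℝ A := ⟨fun c a => A.op (c • CInf.proj 0) ![a]⟩

variable {A} {n : ℕ} (a : Fin n → A) (f g : CInf n)

theorem op_add : A.op (f + g) a = A.op f a + A.op g a := by
  have h : f + g = CInf.comp (CInf.proj 0 + CInf.proj 1) ![f, g] := rfl
  rw [h, A.op_comp]
  refine congrArg (A.op _) (funext fun i => ?_)
  fin_cases i <;> rfl

theorem op_mul : A.op (f * g) a = A.op f a * A.op g a := by
  have h : f * g = CInf.comp (CInf.proj 0 * CInf.proj 1) ![f, g] := rfl
  rw [h, A.op_comp]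
  refine congrArg (A.op _) (funext fun i => ?_)
  fin_cases i <;> rfl

theorem op_neg : A.op (-f) a = -A.op f a := by
  have h : -f = CInf.comp (-CInf.proj 0) ![f] := rfl
  rw [h, A.op_comp]
  refine congrArg (A.op _) (funext fun i => ?_)
  fin_cases i; rfl

theorem op_smul (c : ℝ) : A.op (c • f) a = c • A.op f a := by
  have h : c • f = CInf.comp (c • CInf.proj 0) ![f] := rfl
  rw [h, A.op_comp]
  refine congrArg (A.op _) (funext fun i => ?_)
  fin_cases i; rfl

theorem op_zero : A.op 0 a = 0 := by
  have h : (0 : CInf n) = CInf.comp (0 : CInf 0) ![] := rfl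
  rw [h, A.op_comp]
  exact congrArg (A.op _) (Subsingleton.elim _ _)

theorem op_one : A.op 1 a = 1 := by
  have h : (1 : CInf n) = CInf.comp (1 : CInf 0) ![] := rfl
  rw [h, A.op_comp]
  exact congrArg (A.op _) (Subsingleton.elim _ _)

/-- Any three elements are the values at one triple of the operations of three projections, so
identities between smooth functions of three variables hold in `A`. -/
theorem exists_triple (x y z : A) : ∃ t : Fin 3 → A, x = A.op (CInf.proj 0) t ∧
    y = A.op (CInf.proj 1) t ∧ z = A.op (CInf.proj 2) t :=
  ⟨![x, y, z], by simp [A.op_proj], by simp [A.op_proj], by simp [A.op_proj]⟩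

noncomputable instance : CommRing A where
  add_assoc x y z := by
    obtain ⟨t, rfl, rfl, rfl⟩ := exists_triple x y z
    simp only [← op_add, add_assoc]
  zero_add x := by
    obtain ⟨t, rfl, -, -⟩ := exists_triple x x x
    simp only [← op_add, ← op_zero t, zero_add]
  add_zero x := by
    obtain ⟨t, rfl, -, -⟩ := exists_triple x x x
    simp only [← op_add, ← op_zero t, add_zero]
  nsmul := nsmulRec
  add_comm x y := by
    obtain ⟨t, rfl, rfl, -⟩ := exists_triple x y y
    simp only [← op_add, add_comm]
  left_distrib x y z := by
    obtain ⟨t, rfl, rfl, rfl⟩ := exists_triple x y z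
    simp only [← op_add, ← op_mul, mul_add]
  right_distrib x y z := by
    obtain ⟨t, rfl, rfl, rfl⟩ := exists_triple x y z
    simp only [← op_add, ← op_mul, add_mul]
  zero_mul x := by
    obtain ⟨t, rfl, -, -⟩ := exists_triple x x x
    simp only [← op_mul, ← op_zero t, zero_mul]
  mul_zero x := by
    obtain ⟨t, rfl, -, -⟩ := exists_triple x x x
    simp only [← op_mul, ← op_zero t, mul_zero]
  mul_assoc x y z := by
    obtain ⟨t, rfl, rfl, rfl⟩ := exists_triple x y z
    simp only [← op_mul, mul_assoc]
  one_mul x := by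
    obtain ⟨t, rfl, -, -⟩ := exists_triple x x x
    simp only [← op_mul, ← op_one t, one_mul]
  mul_one x := by
    obtain ⟨t, rfl, -, -⟩ := exists_triple x x x
    simp only [← op_mul, ← op_one t, mul_one]
  zsmul := zsmulRec
  neg_add_cancel x := by
    obtain ⟨t, rfl, -, -⟩ := exists_triple x x x
    simp only [← op_add, ← op_neg, ← op_zero t, neg_add_cancel]
  mul_comm x y := by
    obtain ⟨t, rfl, rfl, -⟩ := exists_triple x y y
    simp only [← op_mul, mul_comm]

noncomputable instance : Module ℝ A where
  one_smul x := by
    obtain ⟨t, rfl, -, -⟩ := exists_triple x x x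
    simp only [← op_smul, one_smul]
  mul_smul c d x := by
    obtain ⟨t, rfl, -, -⟩ := exists_triple x x x
    simp only [← op_smul, mul_smul]
  smul_zero c := by simp only [← op_smul, ← op_zero (A := A) ![], smul_zero]
  smul_add c x y := by
    obtain ⟨t, rfl, rfl, -⟩ := exists_triple x y y
    simp only [← op_smul, ← op_add, smul_add]
  add_smul c d x := by
    obtain ⟨t, rfl, -, -⟩ := exists_triple x x x
    simp only [← op_smul, ← op_add, add_smul]
  zero_smul x := by
    obtain ⟨t, rfl, -, -⟩ := exists_triple x x x
    simp only [← op_smul, ← op_zero t, zero_smul]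

noncomputable instance : Algebra ℝ A :=
  Algebra.ofModule
    (fun c x y => by
      obtain ⟨t, rfl, rfl, -⟩ := exists_triple x y y
      simp only [← op_smul, ← op_mul, smul_mul_assoc])
    (fun c x y => by
      obtain ⟨t, rfl, rfl, -⟩ := exists_triple x y y
      simp only [← op_smul, ← op_mul, mul_smul_comm])

theorem op_sum {ι : Type} (s : Finset ι) (f : ι → CInf n) :
    A.op (∑ j ∈ s, f j) a = ∑ j ∈ s, A.op (f j) a := by
  classical
  induction s using Finset.induction_on with
  | empty => simp [op_zero]
  | insert i s hi ih => rw [Finset.sum_insert hi, Finset.sum_insert hi, op_add, ih]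

theorem op_linForm (c : Fin n → ℝ) : A.op (CInf.linForm c) a = ∑ j, c j • a j := by
  simp only [CInf.linForm, op_sum, op_smul, A.op_proj]

end Algebra

/-- Morphisms of `C^∞`-rings: maps preserving all the operations. -/
@[ext]
structure Hom (A B : CInfRing) where
  toFun : A → B
  map_op : ∀ {n : ℕ} (f : CInf n) (a : Fin n → A), toFun (A.op f a) = B.op f fun i => toFun (a i)

instance : Category CInfRing where
  Hom := Hom
  id A := ⟨id, fun _ _ => rfl⟩
  comp φ ψ := ⟨ψ.toFun ∘ φ.toFun, fun f a => by simp [φ.map_op, ψ.map_op]⟩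

theorem hom_ext {A B : CInfRing} {φ ψ : A ⟶ B} (h : ∀ x, φ.toFun x = ψ.toFun x) : φ = ψ :=
  Hom.ext (funext h)

/-- The algebra homomorphism underlying a morphism of `C^∞`-rings. -/
noncomputable def Hom.toAlgHom {A B : CInfRing} (φ : A ⟶ B) : A →ₐ[ℝ] B :=
  AlgHom.ofLinearMap
    { toFun := φ.toFun
      map_add' := fun x y => by
        obtain ⟨t, rfl, rfl, -⟩ := exists_triple x y y
        simp only [← op_add, φ.map_op]
      map_smul' := fun c x => by
        obtain ⟨t, rfl, -, -⟩ := exists_triple x x x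
        simp only [← op_smul, φ.map_op, RingHom.id_apply] }
    (by
      change φ.toFun 1 = 1
      rw [← op_one (A := A) ![], φ.map_op, op_one])
    (fun x y => by
      change φ.toFun (x * y) = φ.toFun x * φ.toFun y
      obtain ⟨t, rfl, rfl, -⟩ := exists_triple x y y
      simp only [← op_mul, φ.map_op])

/-- The forgetful functor from `C^∞`-rings to real vector spaces. -/
noncomputable def forget : CInfRing ⥤ ModuleCat.{0} ℝ where
  obj A := ModuleCat.of ℝ A
  map φ := ModuleCat.ofHom (Hom.toAlgHom φ).toLinearMap

end CInfRing

/-! ### The free `C^∞`-ring on a vector space -/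

section FreeRing

variable {V : Type} [AddCommGroup V] [Module ℝ V]

/-- The function on the algebraic dual of `V` obtained by applying a smooth function `g` to
finitely many vectors of `V`, regarded as linear functions on the dual. -/
def smoothEval {n : ℕ} (v : Fin n → V) (g : CInf n) (ξ : Module.Dual ℝ V) : ℝ :=
  g.1 fun i => ξ (v i)

variable (V) in
/-- The functions on the algebraic dual of `V` which depend smoothly on finitely many vectors. -/
def SInf : Type :=
  {h : Module.Dual ℝ V → ℝ // ∃ (n : ℕ) (v : Fin n → V) (g : CInf n), h = smoothEval v g}

namespace SInf

/-- The element of `S^∞(V)` given by a smooth function of finitely many vectors `v`; for fixed `v`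
this is the map `C^∞(ℝⁿ) = S^∞(ℝⁿ) → S^∞(V)` induced by the linear map `ℝⁿ → V`, `eᵢ ↦ vᵢ`. -/
def mk {n : ℕ} (v : Fin n → V) (g : CInf n) : SInf V := ⟨smoothEval v g, n, v, g, rfl⟩

theorem mk_apply {n : ℕ} (v : Fin n → V) (g : CInf n) (ξ : Module.Dual ℝ V) :
    (mk v g).1 ξ = g.1 fun i => ξ (v i) := rfl

@[ext]
theorem ext {h h' : SInf V} (H : ∀ ξ, h.1 ξ = h'.1 ξ) : h = h' := Subtype.ext (funext H)

theorem exists_mk (h : SInf V) : ∃ (n : ℕ) (v : Fin n → V) (g : CInf n), h = mk v g := by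
  obtain ⟨h, n, v, g, rfl⟩ := h
  exact ⟨n, v, g, rfl⟩

/-- Finitely many elements of `S^∞(V)` are smooth functions of the same vectors. -/
theorem exists_common {m : ℕ} (a : Fin m → SInf V) :
    ∃ (k : ℕ) (b : Fin k → V) (f : Fin m → CInf k), ∀ i, a i = mk b (f i) := by
  choose n v g h using fun i => exists_mk (a i)
  let e : (Σ i : Fin m, Fin (n i)) ≃ Fin (Fintype.card (Σ i : Fin m, Fin (n i))) :=
    Fintype.equivFin _
  refine ⟨_, fun j => v (e.symm j).1 (e.symm j).2,
    fun i => CInf.comp (g i) fun j => CInf.proj (e ⟨i, j⟩), fun i => ?_⟩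
  rw [h i]
  ext ξ
  have : ∀ s : (Σ i : Fin m, Fin (n i)), v (e.symm (e s)).1 (e.symm (e s)).2 = v s.1 s.2 :=
    fun s => by rw [e.symm_apply_apply]
  change (g i).1 (fun j => ξ (v i j)) = (g i).1 fun j => ξ (v (e.symm (e ⟨i, j⟩)).1
    (e.symm (e ⟨i, j⟩)).2)
  exact congrArg (g i).1 (funext fun j => congrArg ξ (this ⟨i, j⟩).symm)

theorem mk_comp {m n : ℕ} (b : Fin n → V) (g : CInf m) (f : Fin m → CInf n) :
    mk b (CInf.comp g f) = ⟨fun ξ => g.1 fun i => (mk b (f i)).1 ξ, n, b, CInf.comp g f, rfl⟩ :=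
  rfl

theorem mk_linear {n k : ℕ} (M : Fin n → Fin k → ℝ) (b : Fin k → V) (g : CInf n) :
    mk (fun i => ∑ j, M i j • b j) g = mk b (CInf.comp g fun i => CInf.linForm (M i)) := by
  ext ξ
  change g.1 (fun i => ξ (∑ j, M i j • b j)) = g.1 fun i => (CInf.linForm (M i)).1 _
  simp only [CInf.linForm_apply, map_sum, map_smul, smul_eq_mul]

theorem mk_injective {k : ℕ} {b : Fin k → V} (hb : LinearIndependent ℝ b) :
    Function.Injective (mk b) := by
  intro g g' h
  refine Subtype.ext (funext fun x => ?_)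
  obtain ⟨ξ, hξ⟩ := LinearMap.exists_extend ((Module.Basis.span hb).constr ℝ x)
  have hx : (fun j => ξ (b j)) = x := funext fun j => by
    have h1 : (Module.Basis.span hb j : V) = b j :=
      congrArg Subtype.val (Module.Basis.span_apply hb j)
    have h2 := LinearMap.congr_fun hξ (Module.Basis.span hb j)
    rw [Module.Basis.constr_basis] at h2
    rw [← h2, ← h1]
    rfl
  have := congrFun (congrArg Subtype.val h) ξ
  rwa [mk_apply, mk_apply, hx] at this

/-- A quantity attached to all presentations of elements of `S^∞(V)`, which is compatible with
linear changes of the vectors, depends only on the element. -/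
theorem presentation_indep {B : Type} (Q : ∀ n : ℕ, (Fin n → V) → CInf n → B)
    (hQ : ∀ {n k : ℕ} (M : Fin n → Fin k → ℝ) (b : Fin k → V) (g : CInf n),
      Q n (fun i => ∑ j, M i j • b j) g = Q k b (CInf.comp g fun i => CInf.linForm (M i)))
    {n n' : ℕ} {v : Fin n → V} {v' : Fin n' → V} {g : CInf n} {g' : CInf n'}
    (h : mk v g = mk v' g') : Q n v g = Q n' v' g' := by
  let W := Submodule.span ℝ (Set.range v ∪ Set.range v')
  have : FiniteDimensional ℝ W :=
    FiniteDimensional.span_of_finite ℝ ((Set.finite_range v).union (Set.finite_range v'))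
  let b := Module.finBasis ℝ W
  have key : ∀ w : W, (w : V) = ∑ j, b.repr w j • (b j : V) := fun w => by
    have h1 := congrArg W.subtype (b.sum_repr w)
    rw [map_sum] at h1
    exact h1.symm
  have hv : ∀ i, v i ∈ W := fun i => Submodule.subset_span (Or.inl ⟨i, rfl⟩)
  have hv' : ∀ i, v' i ∈ W := fun i => Submodule.subset_span (Or.inr ⟨i, rfl⟩)
  have e : v = fun i => ∑ j, b.repr ⟨v i, hv i⟩ j • (b j : V) := funext fun i => key ⟨v i, hv i⟩
  have e' : v' = fun i => ∑ j, b.repr ⟨v' i, hv' i⟩ j • (b j : V) :=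
    funext fun i => key ⟨v' i, hv' i⟩
  have hb : LinearIndependent ℝ fun j => (b j : V) :=
    b.linearIndependent.map' W.subtype (Submodule.ker_subtype W)
  rw [e, e', mk_linear, mk_linear] at h
  rw [e, e', hQ, hQ, mk_injective hb h]

variable (V) in
/-- The free `C^∞`-ring on `V`, with pointwise operations. -/
def ring : CInfRing where
  carrier := SInf V
  op {m} g a := ⟨fun ξ => g.1 fun i => (a i).1 ξ, by
    obtain ⟨k, b, f, h⟩ := exists_common a
    refine ⟨k, b, CInf.comp g f, funext fun ξ => ?_⟩
    simp only [h]
    rfl⟩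
  op_proj _ _ := rfl
  op_comp _ _ _ := rfl

theorem op_mk {m n : ℕ} (b : Fin n → V) (g : CInf m) (f : Fin m → CInf n) :
    (ring V).op g (fun i => mk b (f i)) = mk b (CInf.comp g f) := rfl

theorem mk_eq_op {n : ℕ} (v : Fin n → V) (g : CInf n) :
    mk v g = (ring V).op g fun i => mk v (CInf.proj i) := rfl

/-- The universal map `V → S^∞(V)`. -/
def unit : V →ₗ[ℝ] ring V where
  toFun v := mk (fun _ : Fin 1 => v) (CInf.proj 0)
  map_add' v w := ext fun ξ => map_add ξ v w
  map_smul' c v := ext fun ξ => map_smul ξ c v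

theorem unit_apply (v : V) (ξ : Module.Dual ℝ V) : (unit v).1 ξ = ξ v := rfl

theorem mk_eq_op_unit {n : ℕ} (v : Fin n → V) (g : CInf n) :
    mk v g = (ring V).op g fun i => unit (v i) := rfl

/-- The action of `S^∞` on linear maps. -/
def map {W : Type} [AddCommGroup W] [Module ℝ W] (φ : V →ₗ[ℝ] W) : ring V ⟶ ring W where
  toFun h := ⟨fun ξ => h.1 (ξ ∘ₗ φ), by
    obtain ⟨n, v, g, rfl⟩ := exists_mk h
    exact ⟨n, φ ∘ v, g, rfl⟩⟩
  map_op _ _ := rfl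

theorem map_mk {W : Type} [AddCommGroup W] [Module ℝ W] (φ : V →ₗ[ℝ] W) {n : ℕ}
    (v : Fin n → V) (g : CInf n) : (map φ).toFun (mk v g) = mk (φ ∘ v) g := rfl

section lift

variable {A : CInfRing} (φ : V →ₗ[ℝ] A)

/-- The function underlying the extension of a linear map to the free `C^∞`-ring. -/
noncomputable def liftFun (h : SInf V) : A :=
  A.op (exists_mk h).choose_spec.choose_spec.choose fun i =>
    φ ((exists_mk h).choose_spec.choose i)

theorem liftFun_mk {n : ℕ} (v : Fin n → V) (g : CInf n) :
    liftFun φ (mk v g) = A.op g fun i => φ (v i) := by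
  refine presentation_indep (fun n v g => A.op g fun i => φ (v i)) ?_
    (exists_mk (mk v g)).choose_spec.choose_spec.choose_spec.symm
  intro n k M b g
  rw [A.op_comp]
  simp only [map_sum, map_smul, CInfRing.op_linForm]

/-- The unique morphism of `C^∞`-rings extending a linear map. -/
noncomputable def lift : ring V ⟶ A where
  toFun := liftFun φ
  map_op g a := by
    obtain ⟨k, b, f, h⟩ := exists_common a
    obtain rfl : a = fun i => mk b (f i) := funext h
    rw [op_mk, liftFun_mk, A.op_comp]
    simp only [liftFun_mk]

theorem lift_mk {n : ℕ} (v : Fin n → V) (g : CInf n) :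
    (lift φ).toFun (mk v g) = A.op g fun i => φ (v i) := liftFun_mk φ v g

theorem lift_unit (v : V) : (lift φ).toFun (unit v) = φ v :=
  (liftFun_mk φ _ _).trans (A.op_proj _ _)

end lift

/-- The free `C^∞`-ring functor. -/
def free : ModuleCat.{0} ℝ ⥤ CInfRing where
  obj V := ring V
  map f := map f.hom

/-- The free `C^∞`-ring functor is left adjoint to the forgetful functor. -/
noncomputable def adj : free ⊣ CInfRing.forget :=
  Adjunction.mkOfUnitCounit
    { unit := { app := fun V => ModuleCat.ofHom (unit (V := V)) }
      counit :=
        { app := fun A => lift (A := A) (LinearMap.id (R := ℝ) (M := A))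
          naturality := fun A B φ => CInfRing.hom_ext fun h => by
            obtain ⟨n, v, g, rfl⟩ := exists_mk (V := A) h
            refine (lift_mk (A := B) _ _ g).trans ?_
            exact ((congrArg φ.toFun (lift_mk (A := A) LinearMap.id v g)).trans (φ.map_op g _)).symm }
      left_triangle := by
        ext V : 2
        refine CInfRing.hom_ext fun h => ?_
        obtain ⟨n, v, g, rfl⟩ := exists_mk (V := V) h
        exact lift_mk (A := ring V) LinearMap.id (fun i => unit (v i)) g
      right_triangle := by
        ext A x
        exact lift_unit (A := A) LinearMap.id x }

end SInf
end FreeRing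

/-! ### Algebra modalities, codifferential categories and co-calculus categories -/

section Codifferential

universe w v

variable {C : Type w} [Category.{v} C] [MonoidalCategory C] [SymmetricCategory C]

variable (C) in
/-- An algebra modality: a monad `S` with natural commutative monoid structures on the objects
`S X`, such that the components of the multiplication `S S X ⟶ S X` are monoid morphisms.
Naturality of the monoid structure says that the maps `S f` are monoid morphisms. -/
structure AlgebraModality where
  S : Monad C
  [monObj : ∀ X : C, MonObj (S.obj X)]
  [isCommMonObj : ∀ X : C, IsCommMonObj (S.obj X)]
  isMonHom_map : ∀ {X Y : C} (f : X ⟶ Y), IsMonHom (S.map f)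
  isMonHom_mul : ∀ X : C, IsMonHom (M := S.obj (S.obj X)) (N := S.obj X) (S.μ.app X)

attribute [instance] AlgebraModality.monObj AlgebraModality.isCommMonObj

namespace AlgebraModality

variable (M : AlgebraModality C)

/-- The multiplication `m : S X ⊗ S X ⟶ S X`. -/
def m (X : C) : M.S.obj X ⊗ M.S.obj X ⟶ M.S.obj X := MonObj.mul

/-- The unit `u : k ⟶ S X`. -/
def u (X : C) : 𝟙_ C ⟶ M.S.obj X := MonObj.one

/-- The action `S X ⊗ Y ⊗ S X ⟶ S X ⊗ Y` multiplying the outer factors, `(1 ⊗ σ)(m ⊗ 1)`. -/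
def mulOuter (X Y : C) : (M.S.obj X ⊗ Y) ⊗ M.S.obj X ⟶ M.S.obj X ⊗ Y :=
  (α_ _ _ _).hom ≫ M.S.obj X ◁ (β_ Y (M.S.obj X)).hom ≫ (α_ _ _ _).inv ≫ M.m X ▷ Y

/-- The action `S X ⊗ (S X ⊗ Y) ⟶ S X ⊗ Y`, `m ⊗ 1`. -/
def mulLeft (X Y : C) : M.S.obj X ⊗ (M.S.obj X ⊗ Y) ⟶ M.S.obj X ⊗ Y :=
  (α_ _ _ _).inv ≫ M.m X ▷ Y

/-- The interchange `1 ⊗ σ` of the last two factors of `S X ⊗ X ⊗ X`. -/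
def swap (X : C) : (M.S.obj X ⊗ X) ⊗ X ⟶ (M.S.obj X ⊗ X) ⊗ X :=
  (α_ _ _ _).hom ≫ M.S.obj X ◁ (β_ X X).hom ≫ (α_ _ _ _).inv

/-- The functor `X ↦ S X ⊗ X`. -/
abbrev tensorId : C ⥤ C := M.S.toFunctor ⊗ 𝟭 C

variable {M} in
/-- The component `S X ⟶ S X ⊗ X` of a transformation `d`. -/
abbrev outComp (d : M.S.toFunctor ⟶ M.tensorId) (X : C) : M.S.obj X ⟶ M.S.obj X ⊗ X := d.app X

variable {M} in
/-- The component `S X ⊗ X ⟶ S X` of a transformation `s`. -/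
abbrev inComp (s : M.tensorId ⟶ M.S.toFunctor) (X : C) : M.S.obj X ⊗ X ⟶ M.S.obj X := s.app X

/-- The coderiving transformation `d° = (1 ⊗ η) m`. -/
def dCirc : M.tensorId ⟶ M.S.toFunctor where
  app X := M.S.obj X ◁ M.S.η.app X ≫ M.m X
  naturality X Y f := by
    have h1 : M.S.η.app X ≫ M.S.map f = f ≫ M.S.η.app Y := (M.S.η.naturality f).symm
    have h2 : M.m X ≫ M.S.map f = (M.S.map f ⊗ₘ M.S.map f) ≫ M.m Y :=
      (M.isMonHom_map f).mul_hom
    change (M.S.map f ⊗ₘ f) ≫ M.S.obj Y ◁ M.S.η.app Y ≫ M.m Y =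
      (M.S.obj X ◁ M.S.η.app X ≫ M.m X) ≫ M.S.map f
    rw [Category.assoc, h2, ← Category.assoc, ← Category.assoc, ← id_tensorHom, ← id_tensorHom,
      tensorHom_comp_tensorHom, tensorHom_comp_tensorHom, h1, Category.comp_id, Category.id_comp]

variable [Preadditive C]

/-- The transformation `S(0) : S ⟹ S`. -/
def zeroMap : M.S.toFunctor ⟶ M.S.toFunctor where
  app X := M.S.map (0 : X ⟶ X)
  naturality X Y f := by simp only [← Functor.map_comp, Limits.comp_zero, Limits.zero_comp]

/-- The axioms of a deriving transformation. -/
structure IsDeriving (d : M.S.toFunctor ⟶ M.tensorId) : Prop where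
  constant : ∀ X, M.u X ≫ outComp d X = 0
  leibniz : ∀ X, M.m X ≫ outComp d X =
    M.S.obj X ◁ outComp d X ≫ M.mulLeft X X + outComp d X ▷ M.S.obj X ≫ M.mulOuter X X
  linear : ∀ X, M.S.η.app X ≫ outComp d X = (λ_ X).inv ≫ M.u X ▷ X
  chain : ∀ X, M.S.μ.app X ≫ outComp d X =
    outComp d (M.S.obj X) ≫ (M.S.μ.app X ⊗ₘ outComp d X) ≫ M.mulLeft X X
  interchange : ∀ X, outComp d X ≫ outComp d X ▷ X = outComp d X ≫ outComp d X ▷ X ≫ M.swap X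

/-- The axioms of an integral transformation. -/
structure IsIntegral (s : M.tensorId ⟶ M.S.toFunctor) : Prop where
  constant : ∀ X, M.u X ▷ X ≫ inComp s X = (λ_ X).hom ≫ M.S.η.app X
  rotaBaxter : ∀ X, (inComp s X ⊗ₘ inComp s X) ≫ M.m X =
    inComp s X ▷ (M.S.obj X ⊗ X) ≫ M.mulLeft X X ≫ inComp s X +
      (M.S.obj X ⊗ X) ◁ inComp s X ≫ M.mulOuter X X ≫ inComp s X
  interchange : ∀ X, inComp s X ▷ X ≫ inComp s X = M.swap X ≫ inComp s X ▷ X ≫ inComp s X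

/-- The deriving transformation `d` and the integral transformation `s` form a co-calculus
category. -/
structure IsCoCalculus (d : M.S.toFunctor ⟶ M.tensorId) (s : M.tensorId ⟶ M.S.toFunctor) :
    Prop where
  isDeriving : M.IsDeriving d
  isIntegral : M.IsIntegral s
  /-- The second fundamental theorem of calculus. -/
  secondFundamental : d ≫ s + M.zeroMap = 𝟙 M.S.toFunctor
  /-- The Poincaré condition. -/
  poincare : ∀ (B X : C) (f : B ⟶ M.S.obj X ⊗ X),
    f ≫ outComp d X ▷ X ≫ M.swap X = f ≫ outComp d X ▷ X → f ≫ inComp s X ≫ outComp d X = f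

/-- The transformation `K = d d° + S(0)`. -/
def K (d : M.S.toFunctor ⟶ M.tensorId) : M.S.toFunctor ⟶ M.S.toFunctor :=
  d ≫ M.dCirc + M.zeroMap

/-- The deriving transformation `d` gives a codifferential category with antiderivatives. -/
structure HasAntiderivatives (d : M.S.toFunctor ⟶ M.tensorId) : Prop where
  isDeriving : M.IsDeriving d
  isIso_K : IsIso (M.K d)

end AlgebraModality

end Codifferential

/-! ### The free `C^∞`-ring modality and the smooth deriving transformation -/

namespace SInf

/-- The free `C^∞`-ring monad on real vector spaces. -/
noncomputable def monad : Monad (ModuleCat.{0} ℝ) := adj.toMonad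

section Modality

/-- The monoid structure on the vector space underlying a `C^∞`-ring. -/
@[reducible]
noncomputable def monObjForget (A : CInfRing) : MonObj (CInfRing.forget.obj A) :=
  ModuleCat.MonModuleEquivalenceAlgebra.inverseObj (AlgCat.of ℝ A)

attribute [local instance] monObjForget

theorem isCommMonObj_forget (A : CInfRing) : IsCommMonObj (CInfRing.forget.obj A) where
  mul_comm := by
    refine ModuleCat.hom_ext (TensorProduct.ext' fun x y => ?_)
    have key : ∀ a b : A, b * a = a * b := fun a b => mul_comm b a
    exact key x y

theorem isMonHom_forget {A B : CInfRing} (φ : A ⟶ B) : IsMonHom (CInfRing.forget.map φ) where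
  one_hom := by
    refine ModuleCat.hom_ext (LinearMap.ext fun r => ?_)
    exact (CInfRing.Hom.toAlgHom φ).commutes r
  mul_hom := by
    refine ModuleCat.hom_ext (TensorProduct.ext' fun x y => ?_)
    have key : ∀ a b : A, CInfRing.Hom.toAlgHom φ (a * b) =
        CInfRing.Hom.toAlgHom φ a * CInfRing.Hom.toAlgHom φ b := fun a b => map_mul _ a b
    exact key x y

/-- The free `C^∞`-ring modality. -/
noncomputable def modality : AlgebraModality (ModuleCat.{0} ℝ) where
  S := monad
  monObj V := monObjForget (free.obj V)
  isCommMonObj V := isCommMonObj_forget (free.obj V)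
  isMonHom_map f := isMonHom_forget (free.map f)
  isMonHom_mul V := isMonHom_forget (adj.counit.app (free.obj V))

end Modality

section deriv

variable {V : Type} [AddCommGroup V] [Module ℝ V]

/-- The element `mk v g` of the ring `S^∞(V)`. -/
def elt {n : ℕ} (v : Fin n → V) (g : CInf n) : ring V := mk v g

/-- The identification `C^∞(ℝⁿ) ≅ S^∞(V)` for a vector space `V` with a basis of `n` elements. -/
theorem elt_basis_bijective {n : ℕ} (b : Module.Basis (Fin n) ℝ V) :
    Function.Bijective fun g : CInf n => elt b g := by
  refine ⟨mk_injective b.linearIndependent, fun h => ?_⟩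
  obtain ⟨k, v, g, rfl⟩ := exists_mk (V := V) h
  have e : v = fun i => ∑ j, b.repr (v i) j • b j := funext fun i => (b.sum_repr (v i)).symm
  refine ⟨CInf.comp g fun i => CInf.linForm (b.repr (v i)), ?_⟩
  conv_rhs => rw [e]
  exact (mk_linear (fun i => b.repr (v i)) b g).symm

/-- `∑ᵢ ∂g/∂xᵢ ⊗ eᵢ`, transported along the linear map `ℝⁿ → V`, `eᵢ ↦ vᵢ`. -/
noncomputable def derivMk (n : ℕ) (v : Fin n → V) (g : CInf n) : ring V ⊗[ℝ] V :=
  ∑ i, elt v (CInf.pderiv i g) ⊗ₜ[ℝ] v i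

theorem elt_add {n : ℕ} (b : Fin n → V) (f g : CInf n) :
    elt b (f + g) = elt b f + elt b g := rfl

theorem elt_smul {n : ℕ} (b : Fin n → V) (c : ℝ) (f : CInf n) :
    elt b (c • f) = c • elt b f := rfl

theorem elt_sum {n : ℕ} {ι : Type} (s : Finset ι) (b : Fin n → V) (f : ι → CInf n) :
    elt b (∑ i ∈ s, f i) = ∑ i ∈ s, elt b (f i) :=
  CInfRing.op_sum (A := ring V) (fun i => unit (b i)) s f

theorem pderiv_comp_linForm {n k : ℕ} (M : Fin n → Fin k → ℝ) (g : CInf n) (j : Fin k) :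
    CInf.pderiv j (CInf.comp g fun i => CInf.linForm (M i)) =
      ∑ i, M i j • CInf.comp (CInf.pderiv i g) fun i => CInf.linForm (M i) := by
  refine Subtype.ext (funext fun x => ?_)
  let L : (Fin k → ℝ) →L[ℝ] (Fin n → ℝ) := LinearMap.toContinuousLinearMap (Matrix.mulVecLin M)
  have hL : ∀ y, (fun i => (CInf.linForm (M i)).1 y) = L y := fun y => funext fun i =>
    CInf.linForm_apply (M i) y
  have h1 : (CInf.comp g fun i => CInf.linForm (M i)).1 = g.1 ∘ L := funext fun y =>
    congrArg g.1 (hL y)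
  have h2 : DifferentiableAt ℝ g.1 (L x) := (CInf.contDiff g).differentiable (by simp) _
  have h3 : L (Pi.single j 1) = ∑ i, M i j • (Pi.single i 1 : Fin n → ℝ) := by
    rw [pi_eq_sum_univ' (L (Pi.single j 1))]
    refine Finset.sum_congr rfl fun i _ => ?_
    have : L (Pi.single j 1) i = M i j := by
      change ∑ l, M i l * (Pi.single j 1 : Fin k → ℝ) l = M i j
      simp [Pi.single_apply]
    rw [this]
  have h4 : (CInf.pderiv j (CInf.comp g fun i => CInf.linForm (M i))).1 x =
      ∑ i, M i j * fderiv ℝ g.1 (L x) (Pi.single i 1) := by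
    change fderiv ℝ (CInf.comp g fun i => CInf.linForm (M i)).1 x (Pi.single j 1) = _
    rw [h1, fderiv_comp x h2 L.differentiableAt, L.fderiv]
    change fderiv ℝ g.1 (L x) (L (Pi.single j 1)) = _
    rw [h3, map_sum]
    simp only [map_smul, smul_eq_mul]
  rw [h4]
  have h5 : ∀ i, (CInf.comp (CInf.pderiv i g) fun i => CInf.linForm (M i)).1 x =
      fderiv ℝ g.1 (L x) (Pi.single i 1) := fun i => congrArg (CInf.pderiv i g).1 (hL x)
  simp only [← h5]
  simp

theorem derivMk_linear {n k : ℕ} (M : Fin n → Fin k → ℝ) (b : Fin k → V) (g : CInf n) :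
    derivMk n (fun i => ∑ j, M i j • b j) g =
      derivMk k b (CInf.comp g fun i => CInf.linForm (M i)) := by
  have h : ∀ i, elt (fun i => ∑ j, M i j • b j) (CInf.pderiv i g) =
      elt b (CInf.comp (CInf.pderiv i g) fun i => CInf.linForm (M i)) := fun i =>
    mk_linear M b _
  simp only [derivMk, h, pderiv_comp_linForm, elt_sum, elt_smul, TensorProduct.tmul_sum,
    TensorProduct.sum_tmul, TensorProduct.tmul_smul, TensorProduct.smul_tmul']
  exact Finset.sum_comm

/-- The function underlying the smooth deriving transformation. -/
noncomputable def derivFun (h : SInf V) : ring V ⊗[ℝ] V :=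
  derivMk _ (exists_mk h).choose_spec.choose (exists_mk h).choose_spec.choose_spec.choose

theorem derivFun_mk {n : ℕ} (v : Fin n → V) (g : CInf n) : derivFun (mk v g) = derivMk n v g :=
  presentation_indep derivMk derivMk_linear
    (exists_mk (mk v g)).choose_spec.choose_spec.choose_spec.symm

theorem pderiv_add {n : ℕ} (i : Fin n) (f g : CInf n) :
    CInf.pderiv i (f + g) = CInf.pderiv i f + CInf.pderiv i g := by
  refine Subtype.ext (funext fun x => ?_)
  change fderiv ℝ (f.1 + g.1) x _ = fderiv ℝ f.1 x _ + fderiv ℝ g.1 x _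
  rw [fderiv_add ((CInf.contDiff f).differentiable (by simp) _)
    ((CInf.contDiff g).differentiable (by simp) _)]
  rfl

theorem pderiv_smul {n : ℕ} (i : Fin n) (c : ℝ) (f : CInf n) :
    CInf.pderiv i (c • f) = c • CInf.pderiv i f := by
  refine Subtype.ext (funext fun x => ?_)
  change fderiv ℝ (c • f.1) x _ = c • fderiv ℝ f.1 x _
  rw [fderiv_const_smul ((CInf.contDiff f).differentiable (by simp) _)]
  rfl

variable (V) in
/-- The smooth deriving transformation on a vector space, `S^∞(V) → S^∞(V) ⊗ V`. -/
noncomputable def derivLinear : ring V →ₗ[ℝ] ring V ⊗[ℝ] V where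
  toFun := derivFun
  map_add' x y := by
    obtain ⟨k, b, f, h⟩ := exists_common (V := V) ![x, y]
    obtain rfl : x = mk b (f 0) := h 0
    obtain rfl : y = mk b (f 1) := h 1
    rw [derivFun_mk, derivFun_mk]
    refine (derivFun_mk b (f 0 + f 1)).trans ?_
    simp only [derivMk, pderiv_add, elt_add, TensorProduct.add_tmul, Finset.sum_add_distrib]
  map_smul' c x := by
    obtain ⟨n, v, g, rfl⟩ := exists_mk (V := V) x
    rw [derivFun_mk]
    refine (derivFun_mk v (c • g)).trans ?_
    simp only [derivMk, pderiv_smul, elt_smul, ← TensorProduct.smul_tmul', Finset.smul_sum,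
      RingHom.id_apply]

theorem derivLinear_mk {n : ℕ} (v : Fin n → V) (g : CInf n) :
    derivLinear V (elt v g) = ∑ i, elt v (CInf.pderiv i g) ⊗ₜ[ℝ] v i :=
  derivFun_mk v g

end deriv

/-- The smooth deriving transformation. -/
noncomputable def smoothDeriv : modality.S.toFunctor ⟶ modality.tensorId where
  app V := ModuleCat.ofHom (derivLinear V)
  naturality V W f := by
    refine ModuleCat.hom_ext (LinearMap.ext fun h => ?_)
    obtain ⟨n, v, g, rfl⟩ := exists_mk (V := V) h
    have h1 : derivLinear W ((map f.hom).toFun (elt v g)) =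
        TensorProduct.map (CInfRing.Hom.toAlgHom (map f.hom)).toLinearMap f.hom
          (derivLinear V (elt v g)) := by
      rw [derivLinear_mk, map_sum]
      exact derivLinear_mk (f.hom ∘ v) g
    exact h1

end SInf

/-!
An element of `S^∞(V)` is a function on the dual of `V` which depends smoothly on finitely many
vectors, and `SInf.der`, the deriving transformation `d`, is a derivation of the algebra `S^∞(V)`.
Its contraction with the radial vector field, `E = d d°`, is the Euler derivation `SInf.euler`, which
is `t d/dt` along each ray. Everything about integration follows from two properties of `E`.

* An element is determined by its Euler derivative and its value at `0` (`SInf.ext_euler`).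
* The operator `1 + E`, which along rays is `f ↦ (t f)'`, is bijective
  (`SInf.eulerAddOne_bijective`). Its inverse is the mean `f ↦ ∫₀¹ f(t ξ) dt`, and the analytic
  input is that the mean of a smooth function is smooth (`ContDiff.intervalIntegral`).

Since `E` is a derivation which fixes the elements of `V`, the map `s(f ⊗ v) = (1 + E)⁻¹(f) v`
satisfies `E s = d°`, and it vanishes at `0`. By the first property, the second fundamental theorem,
the Rota-Baxter identity and the interchange law for `s` may be checked after applying `E`, where
they become identities of commutative algebra. The map `K = E + S(0)` is injective by the first
property; it is surjective as `K s = d°` and, by the second fundamental theorem, every `f - f(0)` is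
in the image of `d°`. Also `K s = d°` says that `s = d° K⁻¹`.

For the Poincaré condition, the Leibniz rule gives Cartan's formula for the radial vector field: a
closed one-form `θ` satisfies `d(d° θ) = ((1 + E) ⊗ 1) θ` (`SInf.der_contract_of_closed`). Applied to
`θ` and to the exact form `d(s θ)`, whose contraction is `E(s θ) = d° θ`, it shows that `(1 + E) ⊗ 1`
takes the same value on both; as it is injective, `d(s θ) = θ`.

The axioms of a deriving transformation are the rules of calculus: the Leibniz rule, the chain rule
and the symmetry of second derivatives.
-/

/-! ### Smoothness of integrals depending on a parameter -/

section ParametricIntegral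

variable {H : Type} [NormedAddCommGroup H] [NormedSpace ℝ H] [LocallyCompactSpace H]

/-- Differentiation under the integral sign. Local compactness of the parameter space bounds the
derivative of the integrand uniformly near `x₀`. -/
theorem hasFDerivAt_intervalIntegral_of_contDiff {E : Type} [NormedAddCommGroup E]
    [NormedSpace ℝ E] [CompleteSpace E] {F : H × ℝ → E} (hF : ContDiff ℝ 1 F) (a b : ℝ) (x₀ : H) :
    HasFDerivAt (fun x => ∫ t in a..b, F (x, t))
      (∫ t in a..b, (fderiv ℝ F (x₀, t)).comp (ContinuousLinearMap.inl ℝ H ℝ)) x₀ := by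
  have hF' : Continuous fun p => (fderiv ℝ F p).comp (ContinuousLinearMap.inl ℝ H ℝ) :=
    (hF.continuous_fderiv (by simp)).clm_comp continuous_const
  obtain ⟨s, hs, hs0⟩ := exists_compact_mem_nhds x₀
  obtain ⟨C, hC⟩ := (hs.prod (isCompact_uIcc (a := a) (b := b))).exists_bound_of_continuousOn
    hF'.continuousOn
  refine intervalIntegral.hasFDerivAt_integral_of_dominated_of_fderiv_le (𝕜 := ℝ)
    (F := fun x t => F (x, t))
    (F' := fun x t => (fderiv ℝ F (x, t)).comp (ContinuousLinearMap.inl ℝ H ℝ))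
    (bound := fun _ => C) hs0 ?_ ?_ ?_ ?_ ?_ ?_
  · exact .of_forall fun x => (hF.continuous.comp (by fun_prop)).aestronglyMeasurable
  · exact (hF.continuous.comp (by fun_prop)).intervalIntegrable _ _
  · exact (hF'.comp (by fun_prop : Continuous fun t : ℝ => (x₀, t))).aestronglyMeasurable
  · exact .of_forall fun t ht x hx => hC (x, t) ⟨hx, Set.uIoc_subset_uIcc ht⟩
  · exact intervalIntegrable_const
  · refine .of_forall fun t _ x _ => ?_
    exact ((hF.differentiable (by simp)) (x, t)).hasFDerivAt.comp x (hasFDerivAt_prodMk_left x t)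

/-- The induction is over all target spaces at once, since the derivative has values in linear
maps. -/
theorem ContDiff.intervalIntegral_nat (n : ℕ) {E : Type} [NormedAddCommGroup E]
    [NormedSpace ℝ E] [CompleteSpace E] {F : H × ℝ → E} (hF : ContDiff ℝ n F) (a b : ℝ) :
    ContDiff ℝ n fun x => ∫ t in a..b, F (x, t) := by
  induction n generalizing E with
  | zero =>
    rw [Nat.cast_zero, contDiff_zero] at hF ⊢
    exact intervalIntegral.continuous_parametric_intervalIntegral_of_continuous'
      (f := fun x t => F (x, t)) hF a b
  | succ n ih =>
    push_cast at hF ⊢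
    refine contDiff_succ_iff_hasFDerivAt.2 ⟨_, ih (F := fun p =>
      (fderiv ℝ F p).comp (ContinuousLinearMap.inl ℝ H ℝ)) ?_, fun x =>
      hasFDerivAt_intervalIntegral_of_contDiff (hF.of_le (by simp)) a b x⟩
    exact (hF.fderiv_right le_rfl).clm_comp contDiff_const

theorem ContDiff.intervalIntegral {E : Type} [NormedAddCommGroup E]
    [NormedSpace ℝ E] [CompleteSpace E] {F : H × ℝ → E} (hF : ContDiff ℝ ∞ F) (a b : ℝ) :
    ContDiff ℝ ∞ fun x => ∫ t in a..b, F (x, t) :=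
  contDiff_infty.2 fun n => (contDiff_infty.1 hF n).intervalIntegral_nat n a b

end ParametricIntegral

/-! ### Partial derivatives of smooth functions -/

namespace CInf

variable {n : ℕ}

theorem differentiable (f : CInf n) : Differentiable ℝ f.1 := (contDiff f).differentiable (by simp)

theorem fderiv_apply_eq_sum (f : CInf n) (x y : Fin n → ℝ) :
    fderiv ℝ f.1 x y = ∑ i, (pderiv i f).1 x * y i := by
  conv_lhs => rw [pi_eq_sum_univ' y, map_sum]
  refine Finset.sum_congr rfl fun i _ => ?_
  rw [map_smul, smul_eq_mul, mul_comm]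
  rfl

theorem pderiv_mul (i : Fin n) (f g : CInf n) :
    pderiv i (f * g) = f * pderiv i g + g * pderiv i f := by
  refine Subtype.ext (funext fun x => ?_)
  change fderiv ℝ (f.1 * g.1) x _ = f.1 x * fderiv ℝ g.1 x _ + g.1 x * fderiv ℝ f.1 x _
  rw [fderiv_mul (differentiable f x) (differentiable g x)]
  rfl

theorem pderiv_proj_self (i : Fin n) : pderiv i (proj i) = 1 := by
  refine Subtype.ext (funext fun x => ?_)
  change fderiv ℝ (ContinuousLinearMap.proj (R := ℝ) (φ := fun _ : Fin n => ℝ) i) x _ = 1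
  rw [ContinuousLinearMap.fderiv]
  simp

theorem pderiv_comm (i j : Fin n) (f : CInf n) : pderiv i (pderiv j f) = pderiv j (pderiv i f) := by
  refine Subtype.ext (funext fun x => ?_)
  have hd : DifferentiableAt ℝ (fderiv ℝ f.1) x :=
    ((contDiff f).fderiv_right (m := ∞) (by simp)).differentiable (by simp) x
  have key : ∀ v w : Fin n → ℝ,
      fderiv ℝ (fun y => fderiv ℝ f.1 y v) x w = fderiv ℝ (fderiv ℝ f.1) x w v := fun v w => by
    rw [fderiv_clm_apply hd (differentiableAt_const _)]
    simp
  have hs : IsSymmSndFDerivAt ℝ f.1 x :=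
    (contDiff_infty.1 (contDiff f) 2).contDiffAt.isSymmSndFDerivAt (by simp)
  exact (key _ _).trans ((hs.eq _ _).trans (key _ _).symm)

theorem pderiv_comp {m : ℕ} (j : Fin n) (g : CInf m) (f : Fin m → CInf n) :
    pderiv j (comp g f) = ∑ i, comp (pderiv i g) f * pderiv j (f i) := by
  refine Subtype.ext (funext fun x => ?_)
  have hf : HasFDerivAt (fun x i => (f i).1 x)
      (ContinuousLinearMap.pi fun i => fderiv ℝ (f i).1 x) x :=
    hasFDerivAt_pi.2 fun i => (differentiable (f i) x).hasFDerivAt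
  have hg := (differentiable g fun i => (f i).1 x).hasFDerivAt.comp x hf
  have h1 : (pderiv j (comp g f)).1 x = fderiv ℝ g.1 (fun i => (f i).1 x)
      (fun i => fderiv ℝ (f i).1 x (Pi.single j 1)) :=
    DFunLike.congr_fun hg.fderiv (Pi.single j 1)
  rw [h1, fderiv_apply_eq_sum]
  simp only [AddSubmonoidClass.coe_finsetSum, Finset.sum_apply]
  rfl

/-- The average `x ↦ ∫₀¹ f(t x) dt` of a smooth function along the segment from `0` to `x`. -/
noncomputable def radialMean (f : CInf n) : CInf n :=
  of (fun x => ∫ t in (0 : ℝ)..1, f.1 (t • x)) <|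
    ContDiff.intervalIntegral (F := fun p : (Fin n → ℝ) × ℝ => f.1 (p.2 • p.1))
      ((contDiff f).comp (contDiff_snd.smul contDiff_fst)) 0 1

theorem mul_radialMean_smul (f : CInf n) (t : ℝ) (x : Fin n → ℝ) :
    t * (radialMean f).1 (t • x) = ∫ r in (0 : ℝ)..t, f.1 (r • x) := by
  have h := intervalIntegral.mul_integral_comp_mul_right (a := 0) (b := 1)
    (f := fun r => f.1 (r • x)) (c := t)
  simp only [zero_mul, one_mul] at h
  rw [← h]
  simp only [radialMean, of, smul_smul]

end CInf

/-! ### The Euler derivation -/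

namespace SInf

variable {V : Type} [AddCommGroup V] [Module ℝ V]

/-- Evaluation of the elements of `S^∞(V)`, as functions on the dual of `V`, at a point. -/
noncomputable def eval (ξ : Module.Dual ℝ V) : ring V →ₐ[ℝ] ℝ :=
  AlgHom.ofLinearMap
    { toFun := fun h => h.1 ξ
      map_add' := fun _ _ => rfl
      map_smul' := fun _ _ => rfl }
    rfl fun _ _ => rfl

theorem eval_elt (ξ : Module.Dual ℝ V) {n : ℕ} (v : Fin n → V) (g : CInf n) :
    eval ξ (elt v g) = g.1 fun i => ξ (v i) := rfl

theorem eval_unit (ξ : Module.Dual ℝ V) (v : V) : eval ξ (unit v) = ξ v := rfl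

theorem ext_eval {f g : ring V} (h : ∀ ξ, eval ξ f = eval ξ g) : f = g := SInf.ext (V := V) h

theorem exists_elt (h : ring V) : ∃ (n : ℕ) (v : Fin n → V) (g : CInf n), h = elt v g :=
  exists_mk (V := V) h

theorem derivLinear_mul (f g : ring V) :
    derivLinear V (f * g) = f • derivLinear V g + g • derivLinear V f := by
  obtain ⟨k, b, a, h⟩ := exists_common (V := V) ![f, g]
  obtain rfl : f = elt b (a 0) := h 0
  obtain rfl : g = elt b (a 1) := h 1
  have hm : ∀ p q : CInf k, elt b p * elt b q = elt b (p * q) := fun _ _ => rfl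
  simp only [hm, derivLinear_mk, CInf.pderiv_mul, elt_add, TensorProduct.add_tmul,
    Finset.sum_add_distrib, Finset.smul_sum, TensorProduct.smul_tmul', smul_eq_mul]

variable (V) in
/-- The smooth deriving transformation on `V`, as a derivation of the algebra `S^∞(V)` with values
in the free module `S^∞(V) ⊗ V`. -/
noncomputable def der : Derivation ℝ (ring V) (ring V ⊗[ℝ] V) :=
  Derivation.mk' (derivLinear V) derivLinear_mul

theorem der_elt {n : ℕ} (v : Fin n → V) (g : CInf n) :
    der V (elt v g) = ∑ i, elt v (CInf.pderiv i g) ⊗ₜ[ℝ] v i := derivLinear_mk v g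

theorem der_unit (v : V) : der V (unit v) = 1 ⊗ₜ[ℝ] v := by
  refine (der_elt (fun _ : Fin 1 => v) (CInf.proj 0)).trans ?_
  rw [Fin.sum_univ_one, CInf.pderiv_proj_self]
  rfl

/-- The chain rule for the operations of the `C^∞`-ring `S^∞(V)`. -/
theorem der_op {n : ℕ} (g : CInf n) (a : Fin n → ring V) :
    der V ((ring V).op g a) = ∑ i, (ring V).op (CInf.pderiv i g) a • der V (a i) := by
  obtain ⟨k, b, f, h⟩ := exists_common (V := V) a
  obtain rfl : a = fun i => elt b (f i) := funext h
  have ho : ∀ g : CInf n, (ring V).op g (fun i => elt b (f i)) = elt b (CInf.comp g f) :=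
    fun _ => rfl
  have hm : ∀ p q : CInf k, elt b (p * q) = elt b p * elt b q := fun _ _ => rfl
  simp only [ho, der_elt, CInf.pderiv_comp, elt_sum, hm, TensorProduct.sum_tmul, Finset.smul_sum,
    TensorProduct.smul_tmul', smul_eq_mul]
  exact Finset.sum_comm

variable (V) in
/-- The coderiving transformation `f ⊗ v ↦ f v`. It is the contraction of a one-form on the dual
of `V` with the radial vector field. -/
noncomputable def contract : ring V ⊗[ℝ] V →ₗ[ring V] ring V :=
  LinearMap.liftBaseChange (ring V) unit

theorem contract_tmul (f : ring V) (v : V) : contract V (f ⊗ₜ[ℝ] v) = f * unit v := by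
  simp [contract]

variable (V) in
/-- The Euler derivation `f ↦ ∑ᵢ xᵢ ∂f/∂xᵢ`. -/
noncomputable def euler : Derivation ℝ (ring V) (ring V) := (contract V).compDer (der V)

theorem euler_apply (f : ring V) : euler V f = contract V (der V f) := rfl

theorem euler_unit (v : V) : euler V (unit v) = unit v := by
  rw [euler_apply, der_unit, contract_tmul, one_mul]

theorem eval_zero_contract (θ : ring V ⊗[ℝ] V) : eval 0 (contract V θ) = 0 := by
  induction θ using TensorProduct.induction_on with
  | zero => simp
  | tmul f v => rw [contract_tmul, map_mul, eval_unit, LinearMap.zero_apply, mul_zero]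
  | add x y hx hy => rw [map_add, map_add, hx, hy, add_zero]

theorem eval_zero_euler (f : ring V) : eval 0 (euler V f) = 0 := eval_zero_contract _

/-- Along the ray through `ξ`, the Euler derivation is `t d/dt`. -/
theorem exists_hasDerivAt_eval_smul (f : ring V) (ξ : Module.Dual ℝ V) (t : ℝ) :
    ∃ c, HasDerivAt (fun s : ℝ => eval (s • ξ) f) c t ∧ eval (t • ξ) (euler V f) = t * c := by
  obtain ⟨n, v, g, rfl⟩ := exists_elt f
  let y : Fin n → ℝ := fun i => ξ (v i)
  have hg : HasDerivAt (fun s : ℝ => g.1 (s • y)) (fderiv ℝ g.1 (t • y) y) t := by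
    have h1 : HasDerivAt (fun s : ℝ => s • y) y t := by
      simpa using (hasDerivAt_id t).smul_const y
    exact (CInf.differentiable g (t • y)).hasFDerivAt.comp_hasDerivAt t h1
  refine ⟨_, hg, ?_⟩
  rw [euler_apply, der_elt, map_sum, map_sum, CInf.fderiv_apply_eq_sum, Finset.mul_sum]
  refine Finset.sum_congr rfl fun i _ => ?_
  rw [contract_tmul, map_mul, eval_unit, eval_elt]
  change (CInf.pderiv i g).1 (t • y) * (t * y i) = _
  ring

/-- An element of `S^∞(V)` is determined by its Euler derivative and its value at the origin. -/
theorem ext_euler {f g : ring V} (h : euler V f = euler V g) (h0 : eval 0 f = eval 0 g) :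
    f = g := by
  refine ext_eval fun ξ => ?_
  choose c hc hc' using exists_hasDerivAt_eval_smul (f - g) ξ
  -- The mean value theorem gives a point `t ≠ 0`, at which `t d/dt` determines `d/dt`.
  obtain ⟨t, ht, hs⟩ := exists_hasDerivAt_eq_slope (fun s : ℝ => eval (s • ξ) (f - g)) c
    zero_lt_one (fun t _ => (hc t).continuousAt.continuousWithinAt) fun t _ => hc t
  have h1 : t * c t = 0 := by rw [← hc', map_sub, h, sub_self, map_zero]
  have h2 : c t = 0 := (mul_eq_zero.1 h1).resolve_left ht.1.ne'
  rw [h2] at hs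
  simp [h0] at hs
  exact sub_eq_zero.1 hs.symm

variable (V) in
/-- The operator `1 + E`, with `E` the Euler derivation. -/
noncomputable def eulerAddOne : ring V →ₗ[ℝ] ring V := LinearMap.id + (euler V).toLinearMap

theorem eulerAddOne_apply (f : ring V) : eulerAddOne V f = f + euler V f := rfl

/-- Along the ray through `ξ`, the operator `1 + E` is `f ↦ (t f)'`. -/
theorem hasDerivAt_mul_eval_smul (f : ring V) (ξ : Module.Dual ℝ V) (t : ℝ) :
    HasDerivAt (fun s : ℝ => s * eval (s • ξ) f) (eval (t • ξ) (eulerAddOne V f)) t := by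
  obtain ⟨c, hc, hc'⟩ := exists_hasDerivAt_eval_smul f ξ t
  rw [eulerAddOne_apply, map_add, hc']
  simpa using (hasDerivAt_id' t).fun_mul hc

/-- If `(1 + E) f = 0`, then `t f` is constant along each ray, and it vanishes at `t = 0`. -/
theorem eulerAddOne_injective : Function.Injective (eulerAddOne V) := by
  refine (injective_iff_map_eq_zero _).2 fun f hf => ext_eval fun ξ => ?_
  have h (t : ℝ) : HasDerivAt (fun s : ℝ => s * eval (s • ξ) f) 0 t := by
    have := hasDerivAt_mul_eval_smul f ξ t
    rwa [hf, map_zero] at this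
  have := is_const_of_deriv_eq_zero (fun t => (h t).differentiableAt) (fun t => (h t).deriv) 1 0
  simpa using this

/-- Along a ray, `t` times the mean of `g` is the primitive of `g`. -/
theorem eulerAddOne_elt_radialMean {n : ℕ} (v : Fin n → V) (g : CInf n) :
    eulerAddOne V (elt v (CInf.radialMean g)) = elt v g := by
  refine ext_eval fun ξ => ?_
  have h1 := hasDerivAt_mul_eval_smul (elt v (CInf.radialMean g)) ξ 1
  let y : Fin n → ℝ := fun i => ξ (v i)
  have e : (fun s : ℝ => s * eval (s • ξ) (elt v (CInf.radialMean g))) =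
      fun s => ∫ r in (0 : ℝ)..s, g.1 (r • y) :=
    funext fun s => CInf.mul_radialMean_smul g s y
  have hc : Continuous fun r : ℝ => g.1 (r • y) :=
    (CInf.contDiff g).continuous.comp (by fun_prop)
  rw [e, one_smul] at h1
  refine (h1.unique (hc.integral_hasStrictDerivAt 0 1).hasDerivAt).trans ?_
  rw [one_smul]
  rfl

theorem eulerAddOne_bijective : Function.Bijective (eulerAddOne V) := by
  refine ⟨eulerAddOne_injective, fun f => ?_⟩
  obtain ⟨n, v, g, rfl⟩ := exists_elt f
  exact ⟨_, eulerAddOne_elt_radialMean v g⟩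

/-! ### Radial integration -/

variable (V) in
/-- The inverse of `1 + E`, which is the averaging operator `f ↦ ∫₀¹ f(t ξ) dt`. -/
noncomputable def mean : ring V →ₗ[ℝ] ring V :=
  (LinearEquiv.ofBijective (eulerAddOne V) eulerAddOne_bijective).symm

theorem mean_add_euler_mean (f : ring V) : mean V f + euler V (mean V f) = f :=
  (LinearEquiv.ofBijective (eulerAddOne V) eulerAddOne_bijective).apply_symm_apply f

variable (V) in
/-- The integral transformation on `V`, `f ⊗ v ↦ v ∫₀¹ f(t ξ) dt`. -/
noncomputable def integ : ring V ⊗[ℝ] V →ₗ[ℝ] ring V :=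
  (contract V).restrictScalars ℝ ∘ₗ (mean V).rTensor V

theorem integ_tmul (f : ring V) (v : V) : integ V (f ⊗ₜ[ℝ] v) = mean V f * unit v :=
  contract_tmul _ _

theorem eval_zero_integ (θ : ring V ⊗[ℝ] V) : eval 0 (integ V θ) = 0 := eval_zero_contract _

theorem euler_integ (θ : ring V ⊗[ℝ] V) : euler V (integ V θ) = contract V θ := by
  induction θ using TensorProduct.induction_on with
  | zero => simp
  | tmul f v =>
    rw [integ_tmul, contract_tmul, Derivation.leibniz, euler_unit, smul_eq_mul, smul_eq_mul,
      mul_comm (unit v), ← add_mul, mean_add_euler_mean]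
  | add x y hx hy => rw [map_add, map_add, map_add, hx, hy]

/-- The second fundamental theorem of calculus, which contains Hadamard's lemma. -/
theorem integ_der (f : ring V) : integ V (der V f) + algebraMap ℝ (ring V) (eval 0 f) = f := by
  refine ext_euler ?_ ?_
  · rw [map_add, euler_integ, Derivation.map_algebraMap, add_zero, euler_apply]
  · rw [map_add, eval_zero_integ, zero_add, AlgHom.commutes]
    rfl

theorem integ_one_tmul (v : V) : integ V (1 ⊗ₜ[ℝ] v) = unit v := by
  refine ext_euler ?_ ?_
  · rw [euler_integ, contract_tmul, one_mul, euler_unit]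
  · rw [eval_zero_integ, eval_unit, LinearMap.zero_apply]

/-- The Rota-Baxter identity: the two terms on the right are those of the Leibniz rule for the Euler
derivative of the product on the left. -/
theorem integ_mul_integ (f g : ring V) (v w : V) :
    integ V (f ⊗ₜ[ℝ] v) * integ V (g ⊗ₜ[ℝ] w) =
      integ V ((integ V (f ⊗ₜ[ℝ] v) * g) ⊗ₜ[ℝ] w) +
        integ V ((f * integ V (g ⊗ₜ[ℝ] w)) ⊗ₜ[ℝ] v) := by
  refine ext_euler ?_ ?_
  · simp only [map_add, Derivation.leibniz, euler_integ, contract_tmul, smul_eq_mul]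
    ring
  · simp only [map_add, map_mul, eval_zero_integ, mul_zero, add_zero]

/-- Both sides have the Euler derivative `f' v w`, where `f'` is the mean of `f`. -/
theorem integ_integ_tmul_comm (f : ring V) (v w : V) :
    integ V (integ V (f ⊗ₜ[ℝ] v) ⊗ₜ[ℝ] w) = integ V (integ V (f ⊗ₜ[ℝ] w) ⊗ₜ[ℝ] v) := by
  refine ext_euler ?_ ?_
  · rw [euler_integ, euler_integ, contract_tmul, contract_tmul, integ_tmul, integ_tmul]
    ring
  · simp only [eval_zero_integ]

variable (V) in
/-- The operator `f ↦ E f + f(0)`, with `E` the Euler derivation. -/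
noncomputable def eulerAddZero : ring V →ₗ[ℝ] ring V :=
  (euler V).toLinearMap + Algebra.linearMap ℝ (ring V) ∘ₗ (eval 0).toLinearMap

theorem eulerAddZero_apply (f : ring V) :
    eulerAddZero V f = euler V f + algebraMap ℝ (ring V) (eval 0 f) := rfl

theorem eulerAddZero_integ (θ : ring V ⊗[ℝ] V) : eulerAddZero V (integ V θ) = contract V θ := by
  rw [eulerAddZero_apply, euler_integ, eval_zero_integ, map_zero, add_zero]

theorem eval_zero_eulerAddZero (f : ring V) : eval 0 (eulerAddZero V f) = eval 0 f := by
  rw [eulerAddZero_apply, map_add, eval_zero_euler, zero_add, AlgHom.commutes]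
  rfl

theorem eulerAddZero_bijective : Function.Bijective (eulerAddZero V) := by
  constructor
  · intro f g h
    have h0 : eval 0 f = eval 0 g := by
      rw [← eval_zero_eulerAddZero f, h, eval_zero_eulerAddZero]
    refine ext_euler ?_ h0
    rw [eulerAddZero_apply, eulerAddZero_apply, h0] at h
    exact add_right_cancel h
  · intro f
    -- `f - f(0)` is the contraction of `θ = (1 + E)⁻¹ df`, so it is the image of `integ V θ`.
    have h : contract V ((mean V).rTensor V (der V f)) = integ V (der V f) := rfl
    refine ⟨integ V ((mean V).rTensor V (der V f)) + algebraMap ℝ (ring V) (eval 0 f), ?_⟩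
    rw [map_add, eulerAddZero_integ, h, eulerAddZero_apply, Derivation.map_algebraMap, zero_add,
      AlgHom.commutes]
    exact integ_der f

/-! ### Closed one-forms -/

variable (V) in
/-- The interchange `f ⊗ v ⊗ w ↦ f ⊗ w ⊗ v`. -/
noncomputable def swapLast : (ring V ⊗[ℝ] V) ⊗[ℝ] V →ₗ[ℝ] (ring V ⊗[ℝ] V) ⊗[ℝ] V :=
  (TensorProduct.rightComm ℝ (ring V) V V).toLinearMap

theorem swapLast_tmul (f : ring V) (v w : V) :
    swapLast V ((f ⊗ₜ[ℝ] v) ⊗ₜ[ℝ] w) = (f ⊗ₜ[ℝ] w) ⊗ₜ[ℝ] v := rfl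

/-- Exact one-forms are closed. -/
theorem rTensor_der_der_swapLast (f : ring V) :
    swapLast V ((der V).toLinearMap.rTensor V (der V f)) =
      (der V).toLinearMap.rTensor V (der V f) := by
  obtain ⟨n, v, g, rfl⟩ := exists_elt f
  have h : (der V).toLinearMap.rTensor V (der V (elt v g)) =
      ∑ i, ∑ j, (elt v (CInf.pderiv j (CInf.pderiv i g)) ⊗ₜ[ℝ] v j) ⊗ₜ[ℝ] v i := by
    rw [der_elt, map_sum]
    refine Finset.sum_congr rfl fun i _ => ?_
    rw [LinearMap.rTensor_tmul]
    refine (congrArg (· ⊗ₜ[ℝ] v i) (der_elt v _)).trans ?_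
    rw [TensorProduct.sum_tmul]
  rw [h]
  simp only [map_sum, swapLast_tmul]
  rw [Finset.sum_comm]
  simp only [CInf.pderiv_comm]

theorem rTensor_contract_swapLast (x : ring V ⊗[ℝ] V) (v : V) :
    ((contract V).restrictScalars ℝ).rTensor V (swapLast V (x ⊗ₜ[ℝ] v)) = unit v • x := by
  induction x using TensorProduct.induction_on with
  | zero => simp
  | tmul f w =>
    rw [swapLast_tmul, LinearMap.rTensor_tmul, LinearMap.restrictScalars_apply, contract_tmul,
      mul_comm, TensorProduct.smul_tmul', smul_eq_mul]
  | add x y hx hy => rw [TensorProduct.add_tmul, map_add, map_add, hx, hy, smul_add]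

/-- Cartan's formula `d ι θ = θ + ι ∇θ` for the radial vector field, the second term being the
contraction of the covariant derivative of `θ` in the index of `θ`. -/
theorem der_contract (θ : ring V ⊗[ℝ] V) :
    der V (contract V θ) = θ + ((contract V).restrictScalars ℝ).rTensor V
      (swapLast V ((der V).toLinearMap.rTensor V θ)) := by
  induction θ using TensorProduct.induction_on with
  | zero => simp
  | tmul f v =>
    rw [LinearMap.rTensor_tmul, rTensor_contract_swapLast, contract_tmul, Derivation.leibniz,
      der_unit, TensorProduct.smul_tmul', smul_eq_mul, mul_one]
    rfl
  | add x y hx hy =>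
    simp only [map_add, hx, hy]
    abel

/-- For a closed one-form `θ`, the differential of its contraction with the radial vector field is
its Lie derivative, `(1 + E) ⊗ 1` applied to `θ`. -/
theorem der_contract_of_closed {θ : ring V ⊗[ℝ] V}
    (h : swapLast V ((der V).toLinearMap.rTensor V θ) = (der V).toLinearMap.rTensor V θ) :
    der V (contract V θ) = (eulerAddOne V).rTensor V θ := by
  have e : (euler V).toLinearMap = (contract V).restrictScalars ℝ ∘ₗ (der V).toLinearMap := rfl
  rw [der_contract, h, ← LinearMap.comp_apply, ← LinearMap.rTensor_comp, ← e, eulerAddOne,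
    LinearMap.rTensor_add, LinearMap.add_apply, LinearMap.rTensor_id_apply]

/-- The Poincaré lemma for one-forms. -/
theorem der_integ_of_closed {θ : ring V ⊗[ℝ] V}
    (h : swapLast V ((der V).toLinearMap.rTensor V θ) = (der V).toLinearMap.rTensor V θ) :
    der V (integ V θ) = θ := by
  -- Both sides are closed, so it suffices to compare their Lie derivatives.
  refine Module.Flat.rTensor_preserves_injective_linearMap (M := V) (eulerAddOne V)
    eulerAddOne_injective ?_
  rw [← der_contract_of_closed h, ← der_contract_of_closed (rTensor_der_der_swapLast _),
    ← euler_apply, euler_integ]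

end SInf

/-! ### The structure maps of the modality as linear maps -/

namespace SInf

section Components

open AlgebraModality

variable (V W : ModuleCat.{0} ℝ)

/-- The action `f ⊗ x ↦ f • x` of the algebra `S^∞(V)` on the free module `S^∞(V) ⊗ W`. -/
noncomputable def smulLeft : ring V ⊗[ℝ] (ring V ⊗[ℝ] W) →ₗ[ℝ] ring V ⊗[ℝ] W :=
  TensorProduct.lift (Algebra.lsmul ℝ ℝ (ring V ⊗[ℝ] W)).toLinearMap

theorem smulLeft_tmul (f : ring V) (x : ring V ⊗[ℝ] W) : smulLeft V W (f ⊗ₜ x) = f • x := rfl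

theorem mulLeft_hom : (modality.mulLeft V W).hom = smulLeft V W :=
  TensorProduct.ext (LinearMap.ext fun _ => TensorProduct.ext' fun _ _ => rfl)

theorem mulOuter_hom : (modality.mulOuter V W).hom =
    smulLeft V W ∘ₗ (TensorProduct.comm ℝ (ring V ⊗[ℝ] W) (ring V)).toLinearMap :=
  TensorProduct.ext_threefold fun f w g => congrArg (· ⊗ₜ[ℝ] w) (mul_comm (G := ring V) f g)

theorem swap_hom : (modality.swap V).hom = swapLast V :=
  TensorProduct.ext_threefold fun _ _ _ => rfl

/-- The multiplication of the monad at `V`, which interprets a smooth function of elements of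
`S^∞(V)` by the operations of this `C^∞`-ring. -/
noncomputable def join : ring (ring V) →ₗ[ℝ] ring V :=
  (CInfRing.Hom.toAlgHom (lift (A := ring V) LinearMap.id)).toLinearMap

theorem join_elt {n : ℕ} (a : Fin n → ring V) (g : CInf n) :
    join V (elt a g) = (ring V).op g a :=
  lift_mk (A := ring V) LinearMap.id _ _

theorem inComp_dCirc_hom : (inComp modality.dCirc V).hom = (contract V).restrictScalars ℝ :=
  TensorProduct.ext' fun f v => (contract_tmul f v).symm

theorem zeroMap_hom : (modality.zeroMap.app V).hom =
    Algebra.linearMap ℝ (ring V) ∘ₗ (eval (V := V) 0).toLinearMap := by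
  refine LinearMap.ext fun (f : ring V) => ext_eval fun ξ => ?_
  exact (congrArg f.1 (LinearMap.comp_zero ξ)).trans ((eval ξ).commutes _).symm

theorem K_hom : ((modality.K smoothDeriv).app V).hom = eulerAddZero V := by
  have h : ((modality.K smoothDeriv).app V).hom =
      (inComp modality.dCirc V).hom ∘ₗ (outComp smoothDeriv V).hom +
        (modality.zeroMap.app V).hom := rfl
  rw [h, inComp_dCirc_hom, zeroMap_hom]
  rfl

theorem isIso_K : IsIso (modality.K smoothDeriv) := by
  have (V : ModuleCat.{0} ℝ) : IsIso ((modality.K smoothDeriv).app V) := by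
    refine (ConcreteCategory.isIso_iff_bijective _).2 ?_
    have h := eulerAddZero_bijective (V := V)
    rw [← K_hom] at h
    exact h
  exact NatIso.isIso_of_isIso_app _

variable [IsIso (modality.K smoothDeriv)]

theorem inComp_integral_hom :
    (inComp (modality.dCirc ≫ inv (modality.K smoothDeriv)) V).hom = integ V := by
  have h1 : inComp (modality.dCirc ≫ inv (modality.K smoothDeriv)) V ≫
      (modality.K smoothDeriv).app V = inComp modality.dCirc V := by
    have h : (modality.dCirc ≫ inv (modality.K smoothDeriv)) ≫ modality.K smoothDeriv =
        modality.dCirc := by simp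
    exact NatTrans.congr_app h V
  have h2 : eulerAddZero V ∘ₗ (inComp (modality.dCirc ≫ inv (modality.K smoothDeriv)) V).hom =
      (contract V).restrictScalars ℝ := by
    rw [← K_hom, ← inComp_dCirc_hom, ← h1]
    rfl
  refine LinearMap.ext fun θ => (eulerAddZero_bijective (V := V)).1 ?_
  exact (LinearMap.congr_fun h2 θ).trans (eulerAddZero_integ θ).symm

end Components

open AlgebraModality

/-! ### The axioms -/

theorem isDeriving_smoothDeriv : modality.IsDeriving smoothDeriv where
  constant V := ModuleCat.hom_ext (LinearMap.ext fun r => (der V).map_algebraMap r)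
  leibniz V := by
    refine ModuleCat.hom_ext (TensorProduct.ext' fun (f : ring V) (g : ring V) => ?_)
    refine ((der V).leibniz f g).trans (congrArg₂ (· + ·) ?_ ?_)
    · exact (LinearMap.congr_fun (mulLeft_hom V V) (f ⊗ₜ[ℝ] der V g)).symm
    · exact (LinearMap.congr_fun (mulOuter_hom V V) (der V f ⊗ₜ[ℝ] g)).symm
  linear V := by
    refine ModuleCat.hom_ext (LinearMap.ext fun (v : V) => ?_)
    exact (der_unit v).trans (congrArg (· ⊗ₜ[ℝ] v) (map_one (algebraMap ℝ (ring V))).symm)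
  chain V := by
    refine ModuleCat.hom_ext (LinearMap.ext fun h => ?_)
    obtain ⟨n, a, g, rfl⟩ := exists_elt (V := ring V) h
    have h : der V (join V (elt a g)) = smulLeft V V
        (TensorProduct.map (join V) (der V).toLinearMap (der (ring V) (elt a g))) := by
      simp only [der_elt, map_sum, join_elt, der_op, TensorProduct.map_tmul, smulLeft_tmul]
      rfl
    rw [← mulLeft_hom] at h
    exact h
  interchange V := by
    refine ModuleCat.hom_ext (LinearMap.ext fun (f : ring V) => ?_)
    have h := rTensor_der_der_swapLast f
    rw [← swap_hom] at h
    exact h.symm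

theorem isIntegral_of_hom_eq_integ {s : modality.tensorId ⟶ modality.S.toFunctor}
    (hs : ∀ V, (inComp s V).hom = integ V) : modality.IsIntegral s := by
  refine ⟨fun V => ?_, fun V => ?_, fun V => ?_⟩
  · refine ModuleCat.hom_ext (TensorProduct.ext' fun (r : ℝ) (v : V) => ?_)
    have h : integ V (algebraMap ℝ (ring V) r ⊗ₜ[ℝ] v) = unit (r • v) := by
      rw [Algebra.algebraMap_eq_smul_one, ← TensorProduct.smul_tmul', map_smul, integ_one_tmul,
        map_smul]
    rw [← hs] at h
    exact h
  · refine ModuleCat.hom_ext (TensorProduct.ext_fourfold' fun (f : ring V) (v : V) (g : ring V)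
      (w : V) => ?_)
    have h := integ_mul_integ f g v w
    rw [← hs] at h
    exact h
  · refine ModuleCat.hom_ext (TensorProduct.ext_threefold fun (f : ring V) (v w : V) => ?_)
    have h := integ_integ_tmul_comm f v w
    rw [← hs] at h
    exact h

theorem isCoCalculus_smoothDeriv [IsIso (modality.K smoothDeriv)] :
    modality.IsCoCalculus smoothDeriv (modality.dCirc ≫ inv (modality.K smoothDeriv)) where
  isDeriving := isDeriving_smoothDeriv
  isIntegral := isIntegral_of_hom_eq_integ fun V => inComp_integral_hom V
  secondFundamental := by
    ext V : 2
    refine ModuleCat.hom_ext (LinearMap.ext fun (f : ring V) => ?_)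
    have h : integ V (der V f) +
        (Algebra.linearMap ℝ (ring V) ∘ₗ (eval (V := V) 0).toLinearMap) f = f := integ_der f
    rw [← inComp_integral_hom, ← zeroMap_hom] at h
    exact h
  poincare B V φ hφ := by
    refine ModuleCat.hom_ext (LinearMap.ext fun b => ?_)
    have h1 := LinearMap.congr_fun (congrArg ModuleCat.Hom.hom hφ) b
    have h2 := der_integ_of_closed (V := V) (θ := φ.hom b) <| by
      rw [← swap_hom]
      exact h1
    rw [← inComp_integral_hom] at h2
    exact h2

end SInf

/-- The smooth deriving transformation on the free `C^∞`-ring modality gives a codifferential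
category with antiderivatives, and `s = d° K⁻¹` makes it a co-calculus category. -/
theorem mainTheorem2 :
    SInf.modality.HasAntiderivatives SInf.smoothDeriv ∧
      ∃ _ : IsIso (SInf.modality.K SInf.smoothDeriv),
        SInf.modality.IsCoCalculus SInf.smoothDeriv
          (SInf.modality.dCirc ≫ inv (SInf.modality.K SInf.smoothDeriv)) :=
  ⟨⟨SInf.isDeriving_smoothDeriv, SInf.isIso_K⟩, SInf.isIso_K,
    have := SInf.isIso_K
    SInf.isCoCalculus_smoothDeriv⟩
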